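/- Let $\mathcal K$ be a triangulated category with suspension $\Sigma$. A class $\mathcal E$ of distinguished triangles of $\mathcal K$ is called \emph{proper} if it is closed under isomorphisms, (de)suspension (triple rotation in both directions), finite direct sums and retracts; it contains the triangles $X\xrightarrow{\mathrm{id}}X\to 0\to\Sigma X$ and $0\to Y\xrightarrow{\mathrm{id}}Y\to 0$; the $\mathcal E$-monomorphisms (first maps of triangles in $\mathcal E$) are closed under homotopy pushouts and the $\mathcal E$-epimorphisms (second maps) under homotopy pullbacks; and $\mathcal E$ is saturated: if the homotopy pullback of a map $g$ along an $\mathcal E$-epimorphism is an $\mathcal E$-epimorphism, then so is $g$. An object $P$ is \emph{$\mathcal E$-projective} if $0\to\mathcal K(P,X)\to\mathcal K(P,Y)\to\mathcal K(P,Z)\to0$ is exact for every triangle $X\to Y\to Z\to\Sigma X$ in $\mathcal E$; \emph{$\mathcal E$-injectives} are defined dually. The proper class $\mathcal E$ is \emph{Frobenius} if every object $X$ receives an $\mathcal E$-epimorphism from an $\mathcal E$-projective and admits an $\mathcal E$-monomorphism to an $\mathcal E$-injective, and $\operatorname{proj}(\mathcal E)=\operatorname{inj}(\mathcal E)$. Let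 $\mathcal E$ be Frobenius and let $\pi\colon\mathcal K\to\mathcal K/\mathcal E$ be the additive quotient of $\mathcal K$ by the morphisms that factor through an object of $\operatorname{proj}(\mathcal E)$. Choose for each $X$ a triangle $X\xrightarrow{i_X}X_{\mathcal E}\xrightarrow{p_X}X'\xrightarrow{\alpha_X}\Sigma X$ in $\mathcal E$ with $X_{\mathcal E}$ $\mathcal E$-injective. The suspension $\Sigma_{\mathcal E}$ of $\mathcal K/\mathcal E$ sends $\pi X$ to $\pi X'$ and $\pi a$, for $a\colon X\to Y$, to $\pi c$, for any morphism $(a,b,c)$ between the chosen triangles of $X$ and $Y$. The distinguished triangles of $\mathcal K/\mathcal E$ are those isomorphic to a triangle $X\xrightarrow{\pi f}Y\xrightarrow{\pi g}Z\xrightarrow{\pi h}X'=\Sigma_{\mathcal E}X$ where $g$ is a homotopy pushout of $i_X$ along $f\colon X\to Y$ and $Y\xrightarrow{g}Z\xrightarrow{h}X'\xrightarrow{\Sigma f\circ\alpha_X}\Sigma Y$ is a distinguished triangle of $\mathcal K$ that receives a morphism of triangles from the chosen triangle of $X$, given by $f$, the map $X_{\mathcal E}\to Z$ of the homotopy pushout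 square, and $\mathrm{id}_{X'}$. An additive functor $F$ from a triangulated category to $\mathcal K/\mathcal E$ is \emph{exact} if there is a natural isomorphism $F\Sigma\cong\Sigma_{\mathcal E}F$ through which $F$ sends distinguished triangles to distinguished triangles. A functor on $\mathcal K$ is a \emph{Verdier localization} if, for some thick subcategory $\mathcal J\subseteq\mathcal K$, it is, up to equivalence, the localization of $\mathcal K$ with respect to the morphisms whose cone lies in $\mathcal J$. Then, for every choice of the triangles above: (a) $\pi$ is exact if and only if $\pi$ is a Verdier localization. (b) Suppose that the equivalent conditions of (a) hold and that $\mathcal K$ is idempotent-complete. Then $\mathcal J:=\operatorname{proj}(\mathcal E)$ is a thick subcategory and there is a thick subcategory $\mathcal J'\subseteq\mathcal K$ such that $\mathcal K(\mathcal J,\mathcal J')=0=\mathcal K(\mathcal J',\mathcal J)$, such that $\mathcal J\times\mathcal J'\to\mathcal K$, $(A,B)\mapsto A\oplus B$, is an equivalence, and such that $\pi|_{\mathcal J'}\colon\mathcal J'\to\mathcal K/\mathcal E$ is an exact equivalence. Moreover $\pi$ is the projection onto the summand $\mathcal J'$: the functors $(A,B)\mapsto\pi(A\oplus B)$ and $(A,B)\mapsto\pi(B)$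 from $\mathcal J\times\mathcal J'$ to $\mathcal K/\mathcal E$ are naturally isomorphic. -/

import Mathlib

open CategoryTheory Limits Pretriangulated ZeroObject

universe v u v' u'

noncomputable section

namespace RelativeStable

section ProperClasses

variable {K : Type u} [Category.{v} K] [HasZeroObject K] [HasShift K ℤ] [Preadditive K]
  [∀ n : ℤ, (shiftFunctor K n).Additive] [Pretriangulated K]

/-- The direct sum of two triangles. -/
def sumTriangle (T T' : Triangle K) : Triangle K :=
  Triangle.mk (biprod.map T.mor₁ T'.mor₁) (biprod.map T.mor₂ T'.mor₂)
    (biprod.desc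
      (T.mor₃ ≫ (biprod.inl : T.obj₁ ⟶ T.obj₁ ⊞ T'.obj₁)⟦(1 : ℤ)⟧')
      (T'.mor₃ ≫ (biprod.inr : T'.obj₁ ⟶ T.obj₁ ⊞ T'.obj₁)⟦(1 : ℤ)⟧'))

/-- The commutative square
```
  A --a--> B
  |        |
  c        b
  v        v
  C --d--> D
```
is homotopy cartesian (equivalently, homotopy cocartesian): it is commutative and
`A ⟶ B ⊞ C ⟶ D` extends to a distinguished triangle. One says that `d` is a homotopy pushout
of `a` along `c`, and that `a` is a homotopy pullback of `d` along `b`. -/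
def IsHomotopyCartesian {A B C D : K} (a : A ⟶ B) (c : A ⟶ C) (b : B ⟶ D) (d : C ⟶ D) : Prop :=
  a ≫ b = c ≫ d ∧
    ∃ δ : D ⟶ A⟦(1 : ℤ)⟧,
      Triangle.mk (biprod.lift a c) (biprod.desc b (-d)) δ ∈ distTriang K

/-- `f` is an `E`-monomorphism: the first map of a triangle in `E`. -/
def IsRelMono (E : ObjectProperty (Triangle K)) {X Y : K} (f : X ⟶ Y) : Prop :=
  ∃ (Z : K) (g : Y ⟶ Z) (h : Z ⟶ X⟦(1 : ℤ)⟧), E (Triangle.mk f g h)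

/-- `g` is an `E`-epimorphism: the second map of a triangle in `E`. -/
def IsRelEpi (E : ObjectProperty (Triangle K)) {Y Z : K} (g : Y ⟶ Z) : Prop :=
  ∃ (X : K) (f : X ⟶ Y) (h : Z ⟶ X⟦(1 : ℤ)⟧), E (Triangle.mk f g h)

/-- Proper classes of triangles. -/
structure IsProperClass (E : ObjectProperty (Triangle K)) : Prop where
  distinguished : ∀ T : Triangle K, E T → T ∈ distTriang K
  of_iso : ∀ T T' : Triangle K, Nonempty (T ≅ T') → E T → E T'
  /-- Closed under suspension and desuspension (triple rotation in both directions). -/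
  suspension : ∀ T : Triangle K, E T ↔ E T.rotate.rotate.rotate
  sum : ∀ T T' : Triangle K, E T → E T' → E (sumTriangle T T')
  retract : ∀ T T' : Triangle K, Nonempty (Retract T T') → E T' → E T
  trivial_left : ∀ X : K, E (Triangle.mk (𝟙 X) (0 : X ⟶ 0) 0)
  trivial_right : ∀ Y : K, E (Triangle.mk (0 : 0 ⟶ Y) (𝟙 Y) 0)
  homotopy_pushout : ∀ {A B C D : K} (a : A ⟶ B) (c : A ⟶ C) (b : B ⟶ D) (d : C ⟶ D),
    IsHomotopyCartesian a c b d → IsRelMono E a → IsRelMono E d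
  homotopy_pullback : ∀ {A B C D : K} (a : A ⟶ B) (c : A ⟶ C) (b : B ⟶ D) (d : C ⟶ D),
    IsHomotopyCartesian a c b d → IsRelEpi E d → IsRelEpi E a
  /-- If the homotopy pullback `a` of `d` along an `E`-epimorphism `b` is an `E`-epimorphism,
  then so is `d`. -/
  saturated : ∀ {A B C D : K} (a : A ⟶ B) (c : A ⟶ C) (b : B ⟶ D) (d : C ⟶ D),
    IsHomotopyCartesian a c b d → IsRelEpi E b → IsRelEpi E a → IsRelEpi E d

/-- The `E`-projective objects: `0 → K(P, X) → K(P, Y) → K(P, Z) → 0` is exact for every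
triangle `X ⟶ Y ⟶ Z ⟶ X⟦1⟧` in `E`. -/
def relProj (E : ObjectProperty (Triangle K)) : ObjectProperty K := fun P =>
  ∀ T : Triangle K, E T →
    Function.Injective (fun a : P ⟶ T.obj₁ => a ≫ T.mor₁) ∧
    Function.Exact (fun a : P ⟶ T.obj₁ => a ≫ T.mor₁) (fun b : P ⟶ T.obj₂ => b ≫ T.mor₂) ∧
    Function.Surjective (fun b : P ⟶ T.obj₂ => b ≫ T.mor₂)

/-- The `E`-injective objects: `0 → K(Z, I) → K(Y, I) → K(X, I) → 0` is exact for every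
triangle `X ⟶ Y ⟶ Z ⟶ X⟦1⟧` in `E`. -/
def relInj (E : ObjectProperty (Triangle K)) : ObjectProperty K := fun I =>
  ∀ T : Triangle K, E T →
    Function.Injective (fun a : T.obj₃ ⟶ I => T.mor₂ ≫ a) ∧
    Function.Exact (fun a : T.obj₃ ⟶ I => T.mor₂ ≫ a) (fun b : T.obj₂ ⟶ I => T.mor₁ ≫ b) ∧
    Function.Surjective (fun b : T.obj₂ ⟶ I => T.mor₁ ≫ b)

/-- Frobenius classes of triangles. -/
structure IsFrobeniusClass (E : ObjectProperty (Triangle K)) : Prop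
    extends IsProperClass E where
  enough_proj : ∀ X : K, ∃ (P : K) (g : P ⟶ X), relProj E P ∧ IsRelEpi E g
  enough_inj : ∀ X : K, ∃ (I : K) (f : X ⟶ I), relInj E I ∧ IsRelMono E f
  proj_eq_inj : relProj E = relInj E

end ProperClasses

section StableCategory

variable {K : Type u} [Category.{v} K] [HasZeroObject K] [HasShift K ℤ] [Preadditive K]
  [∀ n : ℤ, (shiftFunctor K n).Additive] [Pretriangulated K]
  (E : ObjectProperty (Triangle K))

/-- Two parallel morphisms are identified when their difference factors through an
`E`-projective object. -/
def stableRel : HomRel K := fun X Y f g =>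
  ∃ (P : K) (a : X ⟶ P) (b : P ⟶ Y), relProj E P ∧ f - g = a ≫ b

lemma relProj_zero : relProj E (0 : K) := by
  intro T _
  refine ⟨fun a b _ => (isZero_zero K).eq_of_src a b, fun b => ⟨fun _ => ⟨0, ?_⟩, fun _ => ?_⟩,
    fun c => ⟨0, (isZero_zero K).eq_of_src _ _⟩⟩ <;> exact (isZero_zero K).eq_of_src _ _

lemma relProj_biprod {P Q : K} (hP : relProj E P) (hQ : relProj E Q) : relProj E (P ⊞ Q) := by
  intro T hT
  obtain ⟨i₁, e₁, s₁⟩ := hP T hT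
  obtain ⟨i₂, e₂, s₂⟩ := hQ T hT
  refine ⟨fun a b hab => ?_, fun b => ⟨fun hb => ?_, ?_⟩, fun c => ?_⟩
  · dsimp at hab
    apply biprod.hom_ext'
    · exact i₁ (by simp [hab])
    · exact i₂ (by simp [hab])
  · dsimp at hb
    obtain ⟨x, hx⟩ := (e₁ (biprod.inl ≫ b)).1 (by simp [hb])
    obtain ⟨y, hy⟩ := (e₂ (biprod.inr ≫ b)).1 (by simp [hb])
    dsimp at hx hy
    refine ⟨biprod.desc x y, ?_⟩
    apply biprod.hom_ext' <;> simp [hx, hy]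
  · rintro ⟨a, rfl⟩
    apply biprod.hom_ext'
    · have := (e₁ ((biprod.inl ≫ a) ≫ T.mor₁)).2 ⟨_, rfl⟩
      simpa using this
    · have := (e₂ ((biprod.inr ≫ a) ≫ T.mor₁)).2 ⟨_, rfl⟩
      simpa using this
  · obtain ⟨x, hx⟩ := s₁ (biprod.inl ≫ c)
    obtain ⟨y, hy⟩ := s₂ (biprod.inr ≫ c)
    dsimp at hx hy
    refine ⟨biprod.desc x y, ?_⟩
    apply biprod.hom_ext' <;> simp [hx, hy]

lemma stableRel_add ⦃X Y : K⦄ (f₁ f₂ g₁ g₂ : X ⟶ Y) (hf : stableRel E f₁ f₂)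
    (hg : stableRel E g₁ g₂) : stableRel E (f₁ + g₁) (f₂ + g₂) := by
  obtain ⟨P, a, b, hP, h⟩ := hf
  obtain ⟨Q, c, d, hQ, h'⟩ := hg
  refine ⟨P ⊞ Q, biprod.lift a c, biprod.desc b d, relProj_biprod E hP hQ, ?_⟩
  rw [biprod.lift_desc, ← h, ← h']
  abel

instance : Congruence (stableRel E) where
  equivalence :=
    { refl := fun f => ⟨0, 0, 0, relProj_zero E, by simp⟩
      symm := by
        rintro f g ⟨P, a, b, hP, h⟩
        exact ⟨P, a, -b, hP, by rw [Preadditive.comp_neg, ← h, neg_sub]⟩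
      trans := by
        intro f g k h h'
        obtain ⟨P, a, b, hP, e⟩ := stableRel_add E _ _ _ _ h h'
        exact ⟨P, a, b, hP, by rw [← e]; abel⟩ }
  comp_left := by
    rintro X Y Z f g g' ⟨P, a, b, hP, h⟩
    exact ⟨P, f ≫ a, b, hP, by rw [Category.assoc, ← h, Preadditive.comp_sub]⟩
  comp_right := by
    rintro X Y Z f f' g ⟨P, a, b, hP, h⟩
    exact ⟨P, a, b ≫ g, hP, by rw [← Category.assoc, ← h, Preadditive.sub_comp]⟩

/-- The `E`-relative stable category: the additive quotient of `K` by the `E`-projectives. -/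
abbrev StableCategory : Type u := CategoryTheory.Quotient (stableRel E)

instance : Preadditive (StableCategory E) := CategoryTheory.Quotient.preadditive _ (stableRel_add E)

/-- The additive quotient functor, which is the identity on objects. -/
abbrev stableProj : K ⥤ StableCategory E := CategoryTheory.Quotient.functor (stableRel E)

/-- A choice, for every object `X`, of a triangle `X ⟶ env X ⟶ cof X ⟶ X⟦1⟧` in `E`
whose first map is an `E`-injective preenvelope. -/
structure PreenvelopeChoice where
  env : K → K
  cof : K → K
  i (X : K) : X ⟶ env X
  p (X : K) : env X ⟶ cof X
  α (X : K) : cof X ⟶ X⟦(1 : ℤ)⟧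
  mem (X : K) : E (Triangle.mk (i X) (p X) (α X))
  inj (X : K) : relInj E (env X)

variable {E}

lemma nonempty_preenvelopeChoice (hE : IsFrobeniusClass E) : Nonempty (PreenvelopeChoice E) := by
  choose I f hI hf using hE.enough_inj
  choose Z g h hT using hf
  exact ⟨⟨I, Z, f, g, h, hT, hI⟩⟩

namespace PreenvelopeChoice

/-- `c` fits in a morphism of triangles
```
  X ----> env X ----> cof X ----> X⟦1⟧
  |         |           |          |
  a         b           c         a⟦1⟧
  v         v           v          v
  Y ----> env Y ----> cof Y ----> Y⟦1⟧
```
-/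
def Lifts (I : PreenvelopeChoice E) {X Y : K} (a : X ⟶ Y) (c : I.cof X ⟶ I.cof Y) : Prop :=
  ∃ b : I.env X ⟶ I.env Y, I.i X ≫ b = a ≫ I.i Y ∧ I.p X ≫ c = b ≫ I.p Y ∧
    I.α X ≫ a⟦(1 : ℤ)⟧' = c ≫ I.α Y

lemma exists_lifts (hE : IsFrobeniusClass E) (I : PreenvelopeChoice E) {X Y : K} (a : X ⟶ Y) :
    ∃ c, I.Lifts a c := by
  obtain ⟨b, hb⟩ := (I.inj Y _ (I.mem X)).2.2 (a ≫ I.i Y)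
  obtain ⟨c, hc⟩ := complete_distinguished_triangle_morphism _ _
    (hE.distinguished _ (I.mem X)) (hE.distinguished _ (I.mem Y)) a b hb
  exact ⟨c, b, hb, hc⟩

lemma map_eq_of_lifts (hE : IsFrobeniusClass E) (I : PreenvelopeChoice E) {X Y : K}
    {a a' : X ⟶ Y} (haa' : stableRel E a a') {c c' : I.cof X ⟶ I.cof Y}
    (hc : I.Lifts a c) (hc' : I.Lifts a' c') :
    (stableProj E).map c = (stableProj E).map c' := by
  apply CategoryTheory.Quotient.sound
  obtain ⟨P, s, t, hP, h⟩ := haa'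
  rw [hE.proj_eq_inj] at hP
  obtain ⟨r, hr⟩ : ∃ r : I.env X ⟶ P, I.i X ≫ r = s := (hP _ (I.mem X)).2.2 s
  have h₀ : I.α X ≫ (I.i X)⟦(1 : ℤ)⟧' = 0 :=
    comp_distTriang_mor_zero₃₁ _ (hE.distinguished _ (I.mem X))
  obtain ⟨_, _, _, hc⟩ := hc
  obtain ⟨_, _, _, hc'⟩ := hc'
  have h₁ : (c - c') ≫ I.α Y = 0 := by
    rw [Preadditive.sub_comp, ← hc, ← hc', ← Preadditive.comp_sub, ← Functor.map_sub, h, ← hr,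
      Category.assoc, Functor.map_comp, reassoc_of% h₀, zero_comp]
  obtain ⟨d, hd⟩ := Triangle.coyoneda_exact₃ _ (hE.distinguished _ (I.mem Y)) (c - c') h₁
  refine ⟨I.env Y, d, I.p Y, ?_, hd⟩
  rw [hE.proj_eq_inj]
  exact I.inj Y

/-- The suspension of the relative stable category, as a functor on `K`: an object `X` is sent to
the image of the cofibre of `X ⟶ env X`. -/
def suspensionAux (hE : IsFrobeniusClass E) (I : PreenvelopeChoice E) : K ⥤ StableCategory E where
  obj X := (stableProj E).obj (I.cof X)
  map a := (stableProj E).map (I.exists_lifts hE a).choose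
  map_id X := by
    rw [← (stableProj E).map_id]
    exact I.map_eq_of_lifts hE (Congruence.equivalence.refl _)
      (I.exists_lifts hE (𝟙 X)).choose_spec ⟨𝟙 _, by simp, by simp, by simp⟩
  map_comp {X Y Z} a a' := by
    rw [← (stableProj E).map_comp]
    refine I.map_eq_of_lifts hE (Congruence.equivalence.refl _)
      (I.exists_lifts hE (a ≫ a')).choose_spec ?_
    obtain ⟨b, h₁, h₂, h₃⟩ := (I.exists_lifts hE a).choose_spec
    obtain ⟨b', h₁', h₂', h₃'⟩ := (I.exists_lifts hE a').choose_spec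
    refine ⟨b ≫ b', ?_, ?_, ?_⟩
    · rw [reassoc_of% h₁, h₁', Category.assoc]
    · rw [reassoc_of% h₂, h₂', Category.assoc]
    · rw [Functor.map_comp, reassoc_of% h₃, h₃', Category.assoc]

/-- The suspension functor `Σ_E` of the relative stable category. -/
def suspension (hE : IsFrobeniusClass E) (I : PreenvelopeChoice E) :
    StableCategory E ⥤ StableCategory E :=
  CategoryTheory.Quotient.lift _ (I.suspensionAux hE) (fun _ _ a a' h =>
    I.map_eq_of_lifts hE h (I.exists_lifts hE a).choose_spec (I.exists_lifts hE a').choose_spec)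

/-- The diagram `A ⟶ B ⟶ C ⟶ cof A` in `K` that represents a basic distinguished triangle of the
relative stable category: `C` is a homotopy pushout of `f` along the preenvelope of `A`, and there
is a morphism of distinguished triangles
```
  A ----> env A ----> cof A ----> A⟦1⟧
  |         |           ‖          |
  f         j           ‖         f⟦1⟧
  v         v           ‖          v
  B --g-->  C  --h--> cof A ----> B⟦1⟧
```
-/
def IsBasicTriangle (I : PreenvelopeChoice E) {A B C : K} (f : A ⟶ B) (g : B ⟶ C)
    (h : C ⟶ I.cof A) : Prop :=
  ∃ j : I.env A ⟶ C, IsHomotopyCartesian (I.i A) f j g ∧ j ≫ h = I.p A ∧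
    Triangle.mk g h (I.α A ≫ f⟦(1 : ℤ)⟧') ∈ distTriang K

/-- The distinguished triangles `X ⟶ Y ⟶ Z ⟶ Σ_E X` of the relative stable category: those
isomorphic to a basic one. -/
def IsDistinguished (hE : IsFrobeniusClass E) (I : PreenvelopeChoice E) {X Y Z : StableCategory E}
    (f : X ⟶ Y) (g : Y ⟶ Z) (h : Z ⟶ (I.suspension hE).obj X) : Prop :=
  ∃ (A B C : K) (f' : A ⟶ B) (g' : B ⟶ C) (h' : C ⟶ I.cof A)
    (a : X ≅ (stableProj E).obj A) (b : Y ≅ (stableProj E).obj B) (c : Z ≅ (stableProj E).obj C),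
    I.IsBasicTriangle f' g' h' ∧
    f ≫ b.hom = a.hom ≫ (stableProj E).map f' ∧
    g ≫ c.hom = b.hom ≫ (stableProj E).map g' ∧
    h ≫ (I.suspension hE).map a.hom = c.hom ≫ (stableProj E).map h'

/-- An additive functor `F` from a triangulated category to the relative stable category is exact
if there is a natural isomorphism `F Σ ≅ Σ_E F` by means of which `F` sends distinguished
triangles to distinguished triangles. -/
def IsExact (hE : IsFrobeniusClass E) (I : PreenvelopeChoice E)
    {C : Type u'} [Category.{v'} C] [HasZeroObject C] [HasShift C ℤ] [Preadditive C]
    [∀ n : ℤ, (shiftFunctor C n).Additive] [Pretriangulated C] (F : C ⥤ StableCategory E) :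
    Prop :=
  F.Additive ∧ ∃ φ : shiftFunctor C (1 : ℤ) ⋙ F ≅ F ⋙ I.suspension hE,
    ∀ T ∈ distTriang C,
      I.IsDistinguished hE (F.map T.mor₁) (F.map T.mor₂) (F.map T.mor₃ ≫ φ.hom.app T.obj₁)

end PreenvelopeChoice

end StableCategory

section Decomposition

variable {K : Type u} [Category.{v} K] [HasZeroObject K] [HasShift K ℤ] [Preadditive K]
  [∀ n : ℤ, (shiftFunctor K n).Additive] [Pretriangulated K]

/-- Thick subcategories: triangulated subcategories closed under direct summands (hence under
isomorphisms). -/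
structure IsThick (J : ObjectProperty K) : Prop where
  triangulated : J.IsTriangulated
  retracts : J.IsStableUnderRetracts

/-- `F` is a Verdier localization: for some thick subcategory `J`, it exhibits its target as the
localization of `K` with respect to the morphisms whose cone belongs to `J`. -/
def IsVerdierLocalization {D : Type u'} [Category.{v'} D] (F : K ⥤ D) : Prop :=
  ∃ J : ObjectProperty K, IsThick J ∧ F.IsLocalization J.trW

/-- The functor `J × J' ⥤ K` that sends `(A, B)` to `A ⊞ B`. -/
def sumFunctor (J J' : ObjectProperty K) : J.FullSubcategory × J'.FullSubcategory ⥤ K where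
  obj X := J.ι.obj X.1 ⊞ J'.ι.obj X.2
  map f := biprod.map (J.ι.map f.1) (J'.ι.map f.2)

/-- `K` is the direct sum of two thick subcategories that are orthogonal both ways. -/
structure IsOrthogonalDecomposition (J J' : ObjectProperty K) : Prop where
  thick_left : IsThick J
  thick_right : IsThick J'
  hom_left_right : ∀ (A B : K), J A → J' B → ∀ f : A ⟶ B, f = 0
  hom_right_left : ∀ (A B : K), J A → J' B → ∀ f : B ⟶ A, f = 0
  isEquivalence : (sumFunctor J J').IsEquivalence

end Decomposition

end RelativeStable

end

noncomputable section

namespace RelativeStable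

variable {K : Type u} [Category.{v} K] [HasZeroObject K] [HasShift K ℤ] [Preadditive K]
  [∀ n : ℤ, (shiftFunctor K n).Additive] [Pretriangulated K]
  {E : ObjectProperty (Triangle K)}

/-! ### Factoring and splitting in distinguished triangles. -/

section Triangles

variable {A B C : K} {f : A ⟶ B} {g : B ⟶ C} {h : C ⟶ A⟦(1 : ℤ)⟧}

/-! Everything rests on the kernel of π being exactly proj(E) (`isZero_stableProj_obj_iff`).

If π is exact, this kernel is thick (`isThick_of_isExact`), and π inverts every map with projective
cone (`IsBasicTriangle.isIso_map`). Any functor inverting those maps inverts the projections P ⊞ X ⟶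
X with P projective, hence cannot distinguish stably equal maps (`map_eq_of_stableRel`). It
therefore factors uniquely through the additive quotient, and π is the localization at proj(E).

Conversely, if π localizes at a thick J, then J is its kernel proj(E)
(`eq_relProj_of_isLocalization`). The cone of each α_X is a shift of a projective, so π(α_X) is
invertible, and minus its inverse compares the two suspensions. The octahedral axiom gives a basic
triangle on any map f (`exists_isHomotopyCartesian`), and a five-lemma argument in the Verdier
quotient identifies it with the image of any distinguished triangle on f.

For (b), J' is the two-sided orthogonal of proj(E). Take an E-epimorphism q from a projective to X
and an E-monomorphism i from X to an injective. The fibre of q ≫ i is projective, which yields r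
with i ≫ r idempotent; splitting it writes X as a projective plus an object of J'
(`exists_decomposition`). -/

lemma exists_factor_of_mor₃_comp_eq_zero (hT : Triangle.mk f g h ∈ distTriang K) {X : K}
    (a : A ⟶ X) (ha : h ≫ a⟦(1 : ℤ)⟧' = 0) : ∃ s : B ⟶ X, a = f ≫ s := by
  obtain ⟨t, ht⟩ : ∃ t : B⟦(1 : ℤ)⟧ ⟶ X⟦(1 : ℤ)⟧, a⟦(1 : ℤ)⟧' = (-f⟦(1 : ℤ)⟧') ≫ t :=
    Triangle.yoneda_exact₃ _ (rot_of_distTriang _ hT) (a⟦(1 : ℤ)⟧') ha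
  obtain ⟨s, rfl⟩ := (shiftFunctor K (1 : ℤ)).map_surjective t
  -- The sign cancels the one that rotation puts on the shift of `f`.
  exact ⟨-s, (shiftFunctor K (1 : ℤ)).map_injective (by simp [ht])⟩

lemma exists_retraction_of_distTriang (hT : Triangle.mk f g h ∈ distTriang K) (h₀ : h = 0) :
    ∃ r : B ⟶ A, f ≫ r = 𝟙 A := by
  obtain ⟨r, hr⟩ := exists_factor_of_mor₃_comp_eq_zero hT (𝟙 A) (by simp [h₀])
  exact ⟨r, hr.symm⟩

lemma exists_section_of_distTriang (hT : Triangle.mk f g h ∈ distTriang K) (h₀ : h = 0) :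
    ∃ s : C ⟶ B, s ≫ g = 𝟙 C := by
  obtain ⟨s, hs⟩ := Triangle.coyoneda_exact₃ _ hT (𝟙 C) ((Category.id_comp _).trans h₀)
  exact ⟨s, hs.symm⟩

lemma mor₃_eq_zero_of_retraction (hT : Triangle.mk f g h ∈ distTriang K) {r : B ⟶ A}
    (hr : f ≫ r = 𝟙 A) : h = 0 := by
  have h₀ : h ≫ f⟦(1 : ℤ)⟧' = 0 := comp_distTriang_mor_zero₃₁ _ hT
  rw [← Category.comp_id h, ← CategoryTheory.Functor.map_id, ← hr, Functor.map_comp, reassoc_of% h₀, zero_comp]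

end Triangles

/-! ### Projectives as the kernel of the stable projection. -/

section Projectives

omit [HasZeroObject K] [∀ n : ℤ, (shiftFunctor K n).Additive] [Pretriangulated K] in
lemma relProj_of_retract {P Q : K} (i : P ⟶ Q) (r : Q ⟶ P) (hir : i ≫ r = 𝟙 P)
    (hQ : relProj E Q) : relProj E P := by
  have key {Z : K} (a : P ⟶ Z) : i ≫ r ≫ a = a := by rw [← Category.assoc, hir, Category.id_comp]
  intro T hT
  obtain ⟨h₁, h₂, h₃⟩ := hQ T hT
  refine ⟨fun a b hab => ?_, fun b => ⟨fun hb => ?_, ?_⟩, fun c => ?_⟩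
  · dsimp at hab
    rw [← key a, ← key b, h₁ (show (r ≫ a) ≫ T.mor₁ = (r ≫ b) ≫ T.mor₁ by simp [hab])]
  · dsimp at hb
    obtain ⟨x, hx⟩ := (h₂ (r ≫ b)).1 (by simp [hb])
    dsimp at hx
    exact ⟨i ≫ x, by simp [hx, key]⟩
  · rintro ⟨a, rfl⟩
    have := (h₂ ((r ≫ a) ≫ T.mor₁)).2 ⟨_, rfl⟩
    dsimp at this ⊢
    simp only [Category.assoc] at this ⊢
    rw [← key (a ≫ _), this, comp_zero]
  · obtain ⟨x, hx⟩ := h₃ (r ≫ c)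
    dsimp at hx
    exact ⟨i ≫ x, by simp [hx, key]⟩

instance : (relProj E).IsStableUnderRetracts where
  of_retract h hY := relProj_of_retract h.i h.r h.retract hY

instance : (relProj E).IsClosedUnderIsomorphisms where
  of_iso e h := relProj_of_retract e.inv e.hom e.inv_hom_id h

instance : (relProj E).ContainsZero where
  exists_zero := ⟨0, isZero_zero K, relProj_zero E⟩

lemma stableProj_map_eq_iff {X Y : K} (f g : X ⟶ Y) :
    (stableProj E).map f = (stableProj E).map g ↔ stableRel E f g :=
  CategoryTheory.Quotient.functor_map_eq_iff _ _ _

instance : (stableProj E).Additive := CategoryTheory.Quotient.functor_additive _ _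

lemma stableProj_map_eq_zero_iff {X Y : K} (f : X ⟶ Y) :
    (stableProj E).map f = 0 ↔
      ∃ (P : K) (a : X ⟶ P) (b : P ⟶ Y), relProj E P ∧ f = a ≫ b := by
  rw [← (stableProj E).map_zero X Y, stableProj_map_eq_iff]
  simp [stableRel]

lemma isZero_stableProj_obj_iff (X : K) : IsZero ((stableProj E).obj X) ↔ relProj E X := by
  rw [IsZero.iff_id_eq_zero, ← (stableProj E).map_id, stableProj_map_eq_zero_iff]
  constructor
  · rintro ⟨P, a, b, hP, h⟩
    exact relProj_of_retract a b h.symm hP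
  · exact fun h => ⟨X, 𝟙 X, 𝟙 X, h, by simp⟩

end Projectives

namespace IsFrobeniusClass

lemma comp_mor₃_eq_zero (hE : IsFrobeniusClass E) {P : K} (hP : relProj E P) {T : Triangle K}
    (hT : E T) (a : P ⟶ T.obj₃) : a ≫ T.mor₃ = 0 := by
  obtain ⟨b, rfl⟩ := (hP T hT).2.2 a
  simp [comp_distTriang_mor_zero₂₃ _ (hE.distinguished _ hT)]

lemma relProj_iff_relInj (hE : IsFrobeniusClass E) (P : K) : relProj E P ↔ relInj E P := by
  rw [hE.proj_eq_inj]

end IsFrobeniusClass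

/-! ### Lifting against preenvelopes. -/

namespace PreenvelopeChoice

variable (hE : IsFrobeniusClass E) (I : PreenvelopeChoice E)

include hE in
lemma relProj_env (X : K) : relProj E (I.env X) := (hE.relProj_iff_relInj _).2 (I.inj X)

include hE in
lemma distinguished (X : K) : Triangle.mk (I.i X) (I.p X) (I.α X) ∈ distTriang K :=
  hE.distinguished _ (I.mem X)

/-- The suspension is built from a chosen lift; this allows it to be computed with any other. -/
lemma suspension_map_of_lifts {X Y : K} {a : X ⟶ Y} {c : I.cof X ⟶ I.cof Y} (h : I.Lifts a c) :
    (I.suspension hE).map ((stableProj E).map a) = (stableProj E).map c :=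
  I.map_eq_of_lifts hE (Congruence.equivalence.refl _) (I.exists_lifts hE a).choose_spec h

include hE in
lemma exists_i_comp_eq {X P : K} (hP : relProj E P) (a : X ⟶ P) :
    ∃ r : I.env X ⟶ P, I.i X ≫ r = a :=
  ((hE.relProj_iff_relInj P).1 hP _ (I.mem X)).2.2 a

omit [HasZeroObject K] [∀ n : ℤ, (shiftFunctor K n).Additive] [Pretriangulated K] in
lemma exists_comp_p_eq {X P : K} (hP : relProj E P) (a : P ⟶ I.cof X) :
    ∃ r : P ⟶ I.env X, r ≫ I.p X = a :=
  (hP _ (I.mem X)).2.2 a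

include hE in
/-- `X` is projective as soon as the cofibre of its preenvelope is. -/
lemma relProj_of_relProj_cof {X : K} (h : relProj E (I.cof X)) : relProj E X := by
  have hα : I.α X = 0 :=
    (Category.id_comp _).symm.trans (hE.comp_mor₃_eq_zero h (I.mem X) (𝟙 (I.cof X)))
  obtain ⟨r, hr⟩ := exists_retraction_of_distTriang (I.distinguished hE X) hα
  exact relProj_of_retract _ _ hr (I.relProj_env hE X)

include hE in
-- As `X` is also injective, its preenvelope splits, so the cofibre is a retract of `env X`.
lemma relProj_cof {X : K} (h : relProj E X) : relProj E (I.cof X) := by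
  obtain ⟨r, hr⟩ := I.exists_i_comp_eq hE h (𝟙 X)
  have hα : I.α X = 0 := mor₃_eq_zero_of_retraction (I.distinguished hE X) hr
  obtain ⟨t, ht⟩ := exists_section_of_distTriang (I.distinguished hE X) hα
  exact relProj_of_retract _ _ ht (I.relProj_env hE X)

end PreenvelopeChoice

/-! ### Exactness implies Verdier localization. -/

namespace PreenvelopeChoice

variable (hE : IsFrobeniusClass E) (I : PreenvelopeChoice E)

include hE

/-- Injectivity of `A` splits the map `A ⟶ env A ⊞ B` of the homotopy pushout, making `C` a retract
of `env A ⊞ B`. -/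
lemma IsBasicTriangle.relProj₃ {A B C : K} {f : A ⟶ B} {g : B ⟶ C} {h : C ⟶ I.cof A}
    (H : I.IsBasicTriangle f g h) (hA : relProj E A) (hB : relProj E B) : relProj E C := by
  obtain ⟨j, ⟨-, δ, hδ⟩, -, -⟩ := H
  obtain ⟨r, hr⟩ := I.exists_i_comp_eq hE hA (𝟙 A)
  have hδ₀ : δ = 0 := mor₃_eq_zero_of_retraction hδ (r := biprod.desc r 0) (by simp [hr])
  obtain ⟨t, ht⟩ := exists_section_of_distTriang hδ hδ₀
  exact relProj_of_retract _ _ ht (relProj_biprod E (I.relProj_env hE A) hB)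

/-- Lifting `h` through `p` yields a map back `f'` with `f ≫ f'` invisible to `α`. The defects from
the two identities die under the connecting maps, so they factor through `env A` and `C`
respectively. -/
lemma IsBasicTriangle.isIso_map {A B C : K} {f : A ⟶ B} {g : B ⟶ C} {h : C ⟶ I.cof A}
    (H : I.IsBasicTriangle f g h) (hC : relProj E C) : IsIso ((stableProj E).map f) := by
  obtain ⟨-, -, -, hT⟩ := H
  have hA := I.distinguished hE A
  obtain ⟨k, hk⟩ := I.exists_comp_p_eq hC h
  obtain ⟨f', -, hf'⟩ : ∃ f' : B ⟶ A, g ≫ k = f' ≫ I.i A ∧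
      (I.α A ≫ f⟦(1 : ℤ)⟧') ≫ f'⟦(1 : ℤ)⟧' = 𝟙 _ ≫ I.α A :=
    complete_distinguished_triangle_morphism₁ _ _ hT hA k (𝟙 _) ((Category.comp_id _).trans hk.symm)
  rw [Category.id_comp, Category.assoc] at hf'
  have e₁ : (stableProj E).map (𝟙 A - f ≫ f') = 0 := by
    obtain ⟨s, hs⟩ := exists_factor_of_mor₃_comp_eq_zero hA (𝟙 A - f ≫ f') (by simp [hf'])
    exact (stableProj_map_eq_zero_iff _).2 ⟨_, _, s, I.relProj_env hE A, hs⟩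
  have e₂ : (stableProj E).map (𝟙 B - f' ≫ f) = 0 := by
    obtain ⟨s, hs⟩ := exists_factor_of_mor₃_comp_eq_zero hT (𝟙 B - f' ≫ f) (by
      simp [reassoc_of% hf'])
    exact (stableProj_map_eq_zero_iff _).2 ⟨_, _, s, hC, hs⟩
  refine ⟨(stableProj E).map f', ?_, ?_⟩
  · rw [Functor.map_sub, sub_eq_zero] at e₁
    simpa using e₁.symm
  · rw [Functor.map_sub, sub_eq_zero] at e₂
    simpa using e₂.symm


variable {I} in
lemma IsDistinguished.relProj₃ {A B C : K} {f : A ⟶ B} {g : B ⟶ C}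
    {h : (stableProj E).obj C ⟶ (I.suspension hE).obj ((stableProj E).obj A)}
    (H : I.IsDistinguished hE ((stableProj E).map f) ((stableProj E).map g) h)
    (hA : relProj E A) (hB : relProj E B) : relProj E C := by
  obtain ⟨A', B', C', f', g', h', a, b, c, H, -⟩ := H
  rw [← isZero_stableProj_obj_iff] at hA hB ⊢
  refine IsZero.of_iso ?_ c
  rw [isZero_stableProj_obj_iff]
  exact H.relProj₃ hE I ((isZero_stableProj_obj_iff _).1 (hA.of_iso a.symm))
    ((isZero_stableProj_obj_iff _).1 (hB.of_iso b.symm))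

variable {I} in
lemma IsDistinguished.isIso_map {A B C : K} {f : A ⟶ B} {g : B ⟶ C}
    {h : (stableProj E).obj C ⟶ (I.suspension hE).obj ((stableProj E).obj A)}
    (H : I.IsDistinguished hE ((stableProj E).map f) ((stableProj E).map g) h)
    (hC : relProj E C) : IsIso ((stableProj E).map f) := by
  obtain ⟨A', B', C', f', g', h', a, b, c, H, hf, -⟩ := H
  rw [← isZero_stableProj_obj_iff] at hC
  have := H.isIso_map hE I ((isZero_stableProj_obj_iff _).1 (hC.of_iso c.symm))
  rw [← Iso.eq_comp_inv] at hf
  rw [hf]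
  infer_instance

lemma isThick_of_isExact (h : I.IsExact hE (stableProj E)) : IsThick (relProj E) := by
  obtain ⟨-, φ, hφ⟩ := h
  have hshift (X : K) : relProj E (X⟦(1 : ℤ)⟧) ↔ relProj E X := by
    rw [← isZero_stableProj_obj_iff]
    -- Exactness replaces the shift by the cofibre of the preenvelope, which is projective exactly
    -- when `X` is.
    refine ((φ.app X).isZero_iff).trans ((isZero_stableProj_obj_iff (I.cof X)).trans
      ⟨I.relProj_of_relProj_cof hE, I.relProj_cof hE⟩)
  have hadd (X : K) (n : ℤ) : relProj E (X⟦n + 1⟧) ↔ relProj E (X⟦n⟧) :=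
    ((relProj E).prop_iff_of_iso ((shiftFunctorAdd' K n 1 (n + 1) rfl).app X)).trans (hshift _)
  have hshift' (X : K) (hX : relProj E X) (n : ℤ) : relProj E (X⟦n⟧) := by
    induction n using Int.induction_on with
    | zero => exact ((relProj E).prop_iff_of_iso ((shiftFunctorZero K ℤ).app X)).2 hX
    | succ n ih => exact (hadd X n).2 ih
    | pred n ih => exact (hadd X (-n - 1)).1 (by simpa using ih)
  have : (relProj E).IsStableUnderShift ℤ := ⟨fun n => ⟨fun X hX => hshift' X hX n⟩⟩
  have : (relProj E).IsTriangulatedClosed₃ :=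
    .mk' fun T hT h₁ h₂ => (hφ T hT).relProj₃ hE h₁ h₂
  have := ObjectProperty.IsTriangulatedClosed₂.of_isTriangulatedClosed₃ (P := relProj E)
  exact ⟨{}, inferInstance⟩

end PreenvelopeChoice

/-- A functor that inverts the morphisms with projective cone identifies stably equal
morphisms. -/
lemma map_eq_of_stableRel [(relProj E).IsStableUnderShift ℤ] {D : Type u'} [Category.{v'} D]
    (F : K ⥤ D) (hF : (relProj E).trW.IsInvertedBy F) {X Y : K} {f g : X ⟶ Y}
    (h : stableRel E f g) : F.map f = F.map g := by
  obtain ⟨P, a, b, hP, h⟩ := h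
  -- The lifts of `(a, 𝟙)` and `(0, 𝟙)` are both sections of this projection, so `F` identifies them
  -- once the projection is inverted.
  have : IsIso (F.map (biprod.snd : P ⊞ X ⟶ X)) :=
    hF _ (ObjectProperty.trW.mk' _ (binaryBiproductTriangle_distinguished P X) hP)
  have e : F.map (biprod.lift a (𝟙 X)) = F.map (biprod.lift 0 (𝟙 X)) := by
    rw [← cancel_mono (F.map (biprod.snd : P ⊞ X ⟶ X)), ← F.map_comp, ← F.map_comp]
    simp
  have hf : f = biprod.lift a (𝟙 X) ≫ biprod.desc b g := by simp [← h]
  have hg : g = biprod.lift 0 (𝟙 X) ≫ biprod.desc b g := by simp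
  rw [hf, F.map_comp, e, ← F.map_comp, ← hg]

/-- The strict universal property of the stable category as a localization. -/
def strictUniversalProperty [(relProj E).IsStableUnderShift ℤ]
    (h : (relProj E).trW.IsInvertedBy (stableProj E)) (D : Type u') [Category.{v'} D] :
    Localization.StrictUniversalPropertyFixedTarget (stableProj E) (relProj E).trW D where
  inverts := h
  lift F hF := CategoryTheory.Quotient.lift _ F fun _ _ _ _ h => map_eq_of_stableRel F hF h
  fac _ _ := CategoryTheory.Quotient.lift_spec _ _ _
  uniq _ _ h := CategoryTheory.Quotient.lift_unique' _ _ _ h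

lemma PreenvelopeChoice.isVerdierLocalization_of_isExact (hE : IsFrobeniusClass E)
    (I : PreenvelopeChoice E) (h : I.IsExact hE (stableProj E)) :
    IsVerdierLocalization (stableProj E) := by
  have hJ := I.isThick_of_isExact hE h
  have := hJ.triangulated
  obtain ⟨-, φ, hφ⟩ := h
  have hinv : (relProj E).trW.IsInvertedBy (stableProj E) := by
    rintro X Y f ⟨Z, g, k, hT, hZ⟩
    exact (hφ _ hT).isIso_map hE hZ
  exact ⟨relProj E, hJ, .mk' _ _ (strictUniversalProperty hinv _) (strictUniversalProperty hinv _)⟩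

/-! ### Homotopy pushouts and kernels of Verdier localizations. -/

section Triangles

lemma binaryBiproductTriangle_swap_distinguished (A B : K) :
    Triangle.mk (biprod.inr : B ⟶ A ⊞ B) (biprod.fst : A ⊞ B ⟶ A) 0 ∈ distTriang K := by
  refine isomorphic_distinguished _ (binaryBiproductTriangle_distinguished B A) _
    (Triangle.isoMk _ _ (Iso.refl B) (biprod.braiding A B) (Iso.refl A) ?_ ?_ ?_)
  · change biprod.inr ≫ (biprod.braiding A B).hom = 𝟙 B ≫ biprod.inl
    apply biprod.hom_ext <;> simp
  · change biprod.fst ≫ 𝟙 A = (biprod.braiding A B).hom ≫ biprod.snd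
    simp
  · change 0 ≫ _ = 𝟙 A ≫ 0
    simp

lemma distinguished_neg₂₃ {A B C : K} {f : A ⟶ B} {g : B ⟶ C} {h : C ⟶ A⟦(1 : ℤ)⟧}
    (hT : Triangle.mk f g h ∈ distTriang K) : Triangle.mk f (-g) (-h) ∈ distTriang K := by
  refine isomorphic_distinguished _ hT _
    (Triangle.isoMk _ _ (Iso.refl A) (Iso.refl B) (-Iso.refl C) ?_ ?_ ?_)
  · exact (Category.comp_id _).trans (Category.id_comp _).symm
  · change (-g) ≫ (-𝟙 C) = 𝟙 B ≫ g
    simp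
  · change (-h) ≫ (shiftFunctor K (1 : ℤ)).map (𝟙 A) = (-𝟙 C) ≫ h
    simp

/-- Homotopy pushouts along the first map of a distinguished triangle exist, and can be chosen to
be compatible with the third object. -/
lemma exists_isHomotopyCartesian [IsTriangulated K] {A B X Y : K} {i : A ⟶ X} {p : X ⟶ Y}
    {α : Y ⟶ A⟦(1 : ℤ)⟧} (hT : Triangle.mk i p α ∈ distTriang K) (f : A ⟶ B) :
    ∃ (C : K) (j : X ⟶ C) (g : B ⟶ C) (h : C ⟶ Y), IsHomotopyCartesian i f j g ∧ j ≫ h = p ∧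
      Triangle.mk g h (α ≫ f⟦(1 : ℤ)⟧') ∈ distTriang K := by
  obtain ⟨C, d, δ, hd⟩ := distinguished_cocone_triangle (biprod.lift i f)
  have hs : Triangle.mk (biprod.fst : X ⊞ B ⟶ X) (0 : X ⟶ B⟦(1 : ℤ)⟧)
      (-(biprod.inr : B ⟶ X ⊞ B)⟦(1 : ℤ)⟧') ∈ distTriang K :=
    rot_of_distTriang _ (binaryBiproductTriangle_swap_distinguished X B)
  -- The octahedron on `A ⟶ X ⊞ B ⟶ X`, whose composite is `i`, relates `C`, `Y` and the shift of
  -- `B`.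
  let o := Triangulated.someOctahedron (biprod.lift_fst i f) hd hs hT
  have h₁ : d ≫ o.m₁ = biprod.fst ≫ p := o.comm₁
  have h₀ : biprod.lift i f ≫ d = 0 := comp_distTriang_mor_zero₁₂ _ hd
  have h₄ : α ≫ (biprod.lift i f)⟦(1 : ℤ)⟧' =
    o.m₃ ≫ (-(biprod.inr : B ⟶ X ⊞ B)⟦(1 : ℤ)⟧') := o.comm₄
  have h₃ : o.m₃ = -(α ≫ f⟦(1 : ℤ)⟧') := by
    have := h₄ =≫ (biprod.snd : X ⊞ B ⟶ B)⟦(1 : ℤ)⟧'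
    simp only [Category.assoc, Preadditive.neg_comp, Preadditive.comp_neg,
      ← CategoryTheory.Functor.map_comp, biprod.lift_snd, biprod.inr_snd,
      CategoryTheory.Functor.map_id, Category.comp_id] at this
    rw [this, neg_neg]
  -- A homotopy cartesian square carries a minus sign on its lower map, so `g` must be `-(biprod.inr
  -- ≫ d)`.
  have hd' : d = biprod.desc (biprod.inl ≫ d) (-(-(biprod.inr ≫ d))) := by
    apply biprod.hom_ext' <;> simp
  refine ⟨C, biprod.inl ≫ d, -(biprod.inr ≫ d), o.m₁, ⟨?_, δ, ?_⟩, ?_, ?_⟩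
  · rw [hd', biprod.lift_desc] at h₀
    rw [← sub_eq_zero, sub_eq_add_neg, ← Preadditive.comp_neg, h₀]
  · rwa [← hd']
  · rw [Category.assoc, h₁, biprod.inl_fst_assoc]
  · rw [rotate_distinguished_triangle]
    have hm := distinguished_neg₂₃ o.mem
    rw [h₃, neg_neg, Preadditive.neg_comp, neg_neg, ← CategoryTheory.Functor.map_comp] at hm
    change Triangle.mk o.m₁ (α ≫ f⟦(1 : ℤ)⟧') (-(-(biprod.inr ≫ d))⟦(1 : ℤ)⟧') ∈ _
    rwa [Functor.map_neg, neg_neg]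

/-- A functor that localizes at a triangulated subcategory inverts the middle component of a
morphism of distinguished triangles as soon as it inverts the other two. -/
lemma isIso_map_hom₂ [IsTriangulated K] (J : ObjectProperty K) [J.IsTriangulated] {D : Type u'}
    [Category.{v'} D] (L : K ⥤ D) [L.IsLocalization J.trW] {T T' : Triangle K} (φ : T ⟶ T')
    (hT : T ∈ distTriang K) (hT' : T' ∈ distTriang K) (h₁ : IsIso (L.map φ.hom₁))
    (h₃ : IsIso (L.map φ.hom₃)) : IsIso (L.map φ.hom₂) := by
  -- The target of `L` has no triangulation, so the question is moved to the standard Verdier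
  -- quotient.
  let e := Localization.compUniqFunctor J.trW.Q L J.trW
  rw [← NatIso.isIso_map_iff e, Functor.comp_map, isIso_iff_of_reflects_iso] at h₁ h₃ ⊢
  exact isIso₂_of_isIso₁₃ (J.trW.Q.mapTriangle.map φ) (J.trW.Q.map_distinguished _ hT)
    (J.trW.Q.map_distinguished _ hT') h₁ h₃

/-- An object killed by the localization at a thick subcategory belongs to it. -/
lemma IsThick.prop_of_isZero [IsTriangulated K] {J : ObjectProperty K} (hJ : IsThick J)
    {D : Type u'} [Category.{v'} D] (L : K ⥤ D) [L.IsLocalization J.trW] {X : K}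
    (hX : L.map (𝟙 X) = L.map 0) : J X := by
  have := hJ.triangulated
  have := hJ.retracts
  -- Equality after localization is witnessed by a map `s` killing the identity of `X`; the fibre of
  -- `s` lies in `J` and retracts onto `X`.
  obtain ⟨Z, s, hs, h⟩ := (MorphismProperty.map_eq_iff_postcomp L J.trW _ _).1 hX
  rw [ObjectProperty.trW_iff'] at hs
  obtain ⟨Y, f, δ, hT, hY⟩ := hs
  obtain ⟨r, hr⟩ : ∃ r : X ⟶ Y, 𝟙 X = r ≫ f :=
    Triangle.coyoneda_exact₂ _ hT (𝟙 X) (h.trans zero_comp)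
  exact J.prop_of_retract ⟨r, f, hr.symm⟩ hY

end Triangles

/-- Both sides are the kernel of π; thickness prevents the kernel from exceeding `J`. -/
lemma eq_relProj_of_isLocalization [IsTriangulated K] {J : ObjectProperty K} (hJ : IsThick J)
    [(stableProj E).IsLocalization J.trW] : J = relProj E := by
  have := hJ.triangulated
  have := hJ.retracts
  ext X
  rw [← isZero_stableProj_obj_iff]
  constructor
  · intro hX
    have : IsIso ((stableProj E).map (0 : X ⟶ 0)) :=
      Localization.inverts _ J.trW _ (.mk J (contractible_distinguished₂ _) (J.le_shift 1 _ hX))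
    exact ((stableProj E).map_isZero (isZero_zero K)).of_iso (asIso ((stableProj E).map (0 : X ⟶ 0)))
  · intro hX
    exact hJ.prop_of_isZero (stableProj E)
      ((((stableProj E).map_id X).trans (hX.eq_of_src _ _)))

lemma IsVerdierLocalization.isThick_relProj [IsTriangulated K]
    (h : IsVerdierLocalization (stableProj E)) :
    IsThick (relProj E) ∧ (stableProj E).IsLocalization (relProj E).trW := by
  obtain ⟨J, hJ, _⟩ := h
  obtain rfl := eq_relProj_of_isLocalization (E := E) hJ
  exact ⟨hJ, inferInstance⟩

/-! ### Verdier localization implies exactness. -/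

namespace PreenvelopeChoice

variable (hE : IsFrobeniusClass E) (I : PreenvelopeChoice E)

/-- When the stable projection inverts the connecting maps `α`, they identify (up to sign) the two
suspensions. -/
def shiftIso [∀ X, IsIso ((stableProj E).map (I.α X))] :
    shiftFunctor K (1 : ℤ) ⋙ stableProj E ≅ stableProj E ⋙ I.suspension hE :=
  -- The sign matches the one that rotating a triangle puts on its first map, which basic triangles
  -- do not carry.
  NatIso.ofComponents (fun X => (-asIso ((stableProj E).map (I.α X))).symm) (fun {X Y} a => by
    obtain ⟨c, hc⟩ := I.exists_lifts hE a
    have h := hc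
    obtain ⟨_, _, _, h⟩ := h
    have h' : (stableProj E).map (I.α X) ≫ (stableProj E).map (a⟦(1 : ℤ)⟧') =
        (stableProj E).map c ≫ (stableProj E).map (I.α Y) := by
      rw [← Functor.map_comp, h, Functor.map_comp]
    have key : (stableProj E).map (a⟦(1 : ℤ)⟧') ≫ (-inv ((stableProj E).map (I.α Y))) =
        (-inv ((stableProj E).map (I.α X))) ≫ (stableProj E).map c := by
      rw [Preadditive.comp_neg, Preadditive.neg_comp, neg_inj, IsIso.comp_inv_eq, Category.assoc,
        ← h', IsIso.inv_hom_id_assoc]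
    exact key.trans (congrArg _ (I.suspension_map_of_lifts hE hc).symm))

lemma isExact_of_isVerdierLocalization [IsTriangulated K]
    (h : IsVerdierLocalization (stableProj E)) : I.IsExact hE (stableProj E) := by
  obtain ⟨⟨_, _⟩, _⟩ := h.isThick_relProj
  have hα (X : K) : IsIso ((stableProj E).map (I.α X)) :=
    Localization.inverts _ (relProj E).trW _
      (.mk _ (rot_of_distTriang _ (rot_of_distTriang _ (I.distinguished hE X)))
        ((relProj E).le_shift 1 _ (I.relProj_env hE X)))
  refine ⟨inferInstance, I.shiftIso hE, fun T hT => ?_⟩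
  obtain ⟨C, j, g, k, h₁, h₂, h₃⟩ := exists_isHomotopyCartesian (I.distinguished hE _) T.mor₁
  have hT' : Triangle.mk T.mor₂ T.mor₃ (-T.mor₁⟦(1 : ℤ)⟧') ∈ distTriang K := rot_of_distTriang _ hT
  have hα' : (I.α T.obj₁ ≫ T.mor₁⟦(1 : ℤ)⟧') ≫ (shiftFunctor K (1 : ℤ)).map (𝟙 T.obj₂) =
      (-I.α T.obj₁) ≫ (-T.mor₁⟦(1 : ℤ)⟧') := by simp
  -- Compare the basic triangle with the rotation of `T`: the outer components `𝟙` and `-α` become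
  -- invertible under π, hence so does `γ`.
  obtain ⟨γ, hγ, hγ'⟩ : ∃ γ : C ⟶ T.obj₃, g ≫ γ = 𝟙 _ ≫ T.mor₂ ∧ k ≫ (-I.α _) = γ ≫ T.mor₃ :=
    complete_distinguished_triangle_morphism₂ _ _ h₃ hT' (𝟙 T.obj₂) (-I.α T.obj₁) hα'
  let φ : Triangle.mk g k (I.α T.obj₁ ≫ T.mor₁⟦(1 : ℤ)⟧') ⟶
    Triangle.mk T.mor₂ T.mor₃ (-T.mor₁⟦(1 : ℤ)⟧') :=
    Triangle.homMk _ _ (𝟙 T.obj₂) γ (-I.α T.obj₁) hγ hγ' hα'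
  have : IsIso ((stableProj E).map γ) :=
    isIso_map_hom₂ (relProj E) (stableProj E) φ h₃ hT'
      (inferInstanceAs (IsIso ((stableProj E).map (𝟙 T.obj₂)))) (by
        change IsIso ((stableProj E).map (-I.α T.obj₁))
        rw [Functor.map_neg]
        exact (-asIso ((stableProj E).map (I.α T.obj₁))).isIso_hom)
  refine ⟨_, _, C, T.mor₁, g, k, Iso.refl _, Iso.refl _, (asIso ((stableProj E).map γ)).symm,
    ⟨j, h₁, h₂, h₃⟩, by simp, ?_, ?_⟩
  · change (stableProj E).map T.mor₂ ≫ inv ((stableProj E).map γ) = 𝟙 _ ≫ (stableProj E).map g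
    rw [IsIso.comp_inv_eq, Category.id_comp, ← Functor.map_comp, hγ, Category.id_comp]
  · have key : (stableProj E).map T.mor₃ ≫ (-inv ((stableProj E).map (I.α T.obj₁))) =
        inv ((stableProj E).map γ) ≫ (stableProj E).map k := by
      rw [IsIso.eq_inv_comp, ← Category.assoc, ← Functor.map_comp, ← hγ', Functor.map_comp,
        Functor.map_neg, Category.assoc, Preadditive.neg_comp, Preadditive.comp_neg,
        Preadditive.comp_neg, Preadditive.comp_neg, neg_neg, IsIso.hom_inv_id, Category.comp_id]
    refine Eq.trans (congrArg (_ ≫ ·) ((I.suspension hE).map_id _)) ?_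
    exact (Category.comp_id _).trans key

end PreenvelopeChoice

/-! ### The orthogonal decomposition of an idempotent complete category. -/

section Decomposition

/-- An idempotent of an idempotent complete preadditive category decomposes its object. -/
lemma exists_biprod_iso_of_idem {X : K} [IsIdempotentComplete K] {e : X ⟶ X}
    (he : e ≫ e = e) : ∃ (A B : K) (φ : A ⊞ B ≅ X),
      φ.inv ≫ biprod.fst ≫ biprod.inl ≫ φ.hom = e := by
  obtain ⟨A, a, p, hap, hpa⟩ := IsIdempotentComplete.idempotents_split X e he
  obtain ⟨B, b, q, hbq, hqb⟩ := IsIdempotentComplete.idempotents_split X (𝟙 X - e) (by simp [he])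
  -- Inserting `a ≫ p` and `b ≫ q`, both identities, exhibits the factor `e ≫ (𝟙 - e) = 0`.
  have haq : a ≫ q = 0 := by
    have : a ≫ q = (a ≫ p) ≫ a ≫ q ≫ (b ≫ q) := by simp [hap, hbq]
    rw [this]
    simp [reassoc_of% hpa, reassoc_of% hqb, reassoc_of% he]
  have hbp : b ≫ p = 0 := by
    have : b ≫ p = (b ≫ q) ≫ b ≫ p ≫ (a ≫ p) := by simp [hap, hbq]
    rw [this]
    simp [reassoc_of% hpa, reassoc_of% hqb, reassoc_of% he]
  refine ⟨A, B, ⟨biprod.desc a b, biprod.lift p q, ?_, ?_⟩, by simp [hpa]⟩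
  · apply biprod.hom_ext' <;> apply biprod.hom_ext <;> simp [hap, hbq, haq, hbp]
  · simp [hpa, hqb]

omit [HasZeroObject K] [HasShift K ℤ] [∀ n : ℤ, (shiftFunctor K n).Additive]
  [Pretriangulated K] in
lemma biprod_map_diagonal_eq [HasBinaryBiproducts K] {A B A' B' : K} (g : A ⊞ B ⟶ A' ⊞ B')
    (h₁ : biprod.inl ≫ g ≫ biprod.snd = 0) (h₂ : biprod.inr ≫ g ≫ biprod.fst = 0) :
    biprod.map (biprod.inl ≫ g ≫ biprod.fst) (biprod.inr ≫ g ≫ biprod.snd) = g := by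
  apply biprod.hom_ext' <;> apply biprod.hom_ext <;> simp [h₁, h₂]

variable (E) in
/-- The objects that are orthogonal to the `E`-projectives on both sides. -/
abbrev projOrthogonal : ObjectProperty K :=
  (relProj E).rightOrthogonal ⊓ (relProj E).leftOrthogonal

/-- Although `q` and `i` need not be epi or mono, they are cancellable against projectives. Since
the fibre `N` of `q ≫ i` is projective, this gives `q = q ≫ i ≫ r` and `i = s ≫ q ≫ i`, whence `i ≫
r ≫ i = i`. -/
lemma IsFrobeniusClass.exists_decomposition (hE : IsFrobeniusClass E)
    [(relProj E).IsTriangulated] [IsIdempotentComplete K] (X : K) :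
    ∃ (A B : K), relProj E A ∧ projOrthogonal E B ∧ Nonempty (A ⊞ B ≅ X) := by
  obtain ⟨Y, i, hY, Z, p, α, hi⟩ := hE.enough_inj X
  have hY' := hY
  rw [← hE.relProj_iff_relInj] at hY'
  obtain ⟨Q, q, hQ, W, w, δ, hq⟩ := hE.enough_proj X
  have cancel_i {P : K} (hP : relProj E P) {a b : P ⟶ X} (h : a ≫ i = b ≫ i) : a = b :=
    (hP _ hi).1 h
  have cancel_q {P : K} (hP : relProj E P) {a b : X ⟶ P} (h : q ≫ a = q ≫ b) : a = b :=
    ((hE.relProj_iff_relInj P).1 hP _ hq).1 h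
  have lift_q {P : K} (hP : relProj E P) (a : P ⟶ X) : ∃ b, b ≫ q = a := (hP _ hq).2.2 a
  have lift_i {P : K} (hP : relProj E P) (a : X ⟶ P) : ∃ b, i ≫ b = a :=
    ((hE.relProj_iff_relInj P).1 hP _ hi).2.2 a
  obtain ⟨N, hN, n, ν, hT⟩ := (relProj E).distinguished_cocone_triangle₁ (q ≫ i) hQ hY'
  have hn : n ≫ q = 0 := cancel_i hN (by
    rw [Category.assoc, zero_comp]
    exact comp_distTriang_mor_zero₁₂ _ hT)
  have hν : i ≫ ν = 0 := cancel_q ((relProj E).le_shift 1 _ hN) (by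
    rw [← Category.assoc, comp_zero]
    exact comp_distTriang_mor_zero₂₃ _ hT)
  obtain ⟨r, hr⟩ : ∃ r : Y ⟶ X, q = (q ≫ i) ≫ r := Triangle.yoneda_exact₂ _ hT q hn
  obtain ⟨s, hs⟩ : ∃ s : X ⟶ Q, i = s ≫ (q ≫ i) := Triangle.coyoneda_exact₃ _ hT i hν
  have hiri : i ≫ r ≫ i = i := by
    have := hr =≫ i
    simp only [Category.assoc] at this
    calc i ≫ r ≫ i = (s ≫ q ≫ i) ≫ r ≫ i := congrArg (· ≫ r ≫ i) hs
      _ = i := by rw [Category.assoc, Category.assoc, ← this, ← hs]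
  obtain ⟨A, B, φ, hφ⟩ := exists_biprod_iso_of_idem (e := i ≫ r) (by simp [reassoc_of% hiri])
  have hqe : q ≫ φ.inv ≫ biprod.fst ≫ biprod.inl ≫ φ.hom = q := by
    rw [hφ, ← Category.assoc, ← hr]
  have hei : φ.inv ≫ biprod.fst ≫ biprod.inl ≫ φ.hom ≫ i = i := by
    simpa [hiri] using hφ =≫ i
  refine ⟨A, B, ?_, ⟨fun P x hP => ?_, fun P x hP => ?_⟩, ⟨φ⟩⟩
  · refine relProj_of_retract (biprod.inl ≫ φ.hom ≫ i) (r ≫ φ.inv ≫ biprod.fst) ?_ hY'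
    simp [← reassoc_of% hφ]
  -- A map from a projective to `X` factors through `q`, which the idempotent fixes; its component
  -- in `B` is thus zero. The last case is dual, with `i` for `q`.
  · obtain ⟨y, hy⟩ := lift_q hP (x ≫ biprod.inr ≫ φ.hom)
    have h := y ≫= hqe
    rw [reassoc_of% hy, hy] at h
    have := h.symm =≫ (φ.inv ≫ biprod.snd)
    simpa using this
  · obtain ⟨z, hz⟩ := lift_i hP (φ.inv ≫ biprod.snd ≫ x)
    have h := (biprod.inr ≫ φ.hom) ≫= (hei =≫ z)
    simp only [Category.assoc, hz] at h
    simpa using h.symm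

/-- Orthogonality makes every map between sums diagonal, whence fullness; essential surjectivity is
`exists_decomposition`. -/
lemma IsFrobeniusClass.isOrthogonalDecomposition (hE : IsFrobeniusClass E)
    (hJ : IsThick (relProj E)) [(projOrthogonal E).IsTriangulated] [IsIdempotentComplete K] :
    IsOrthogonalDecomposition (relProj E) (projOrthogonal E) where
  thick_left := hJ
  thick_right :=
    { triangulated := inferInstance
      retracts := ⟨fun {X Y} h hY => ⟨fun P x hP => by
          rw [← Category.comp_id x, ← h.retract, ← Category.assoc, hY.1 (x ≫ h.i) hP, zero_comp],
        fun P x hP => by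
          rw [← Category.id_comp x, ← h.retract, Category.assoc, hY.2 (h.r ≫ x) hP, comp_zero]⟩⟩ }
  hom_left_right A B hA hB f := hB.1 f hA
  hom_right_left A B hA hB f := hB.2 f hA
  isEquivalence :=
    { faithful := ⟨fun {X Y f g} h => by
        change biprod.map _ _ = biprod.map _ _ at h
        ext
        · simpa using biprod.inl ≫= h =≫ biprod.fst
        · simpa using biprod.inr ≫= h =≫ biprod.snd⟩
      full := ⟨fun {X Y} g => ⟨(ObjectProperty.homMk (biprod.inl ≫ g ≫ biprod.fst),
          ObjectProperty.homMk (biprod.inr ≫ g ≫ biprod.snd)), by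
        have h₁ : biprod.inl ≫ g ≫ biprod.snd = 0 := Y.2.2.1 _ X.1.2
        have h₂ : biprod.inr ≫ g ≫ biprod.fst = 0 := X.2.2.2 _ Y.1.2
        exact biprod_map_diagonal_eq g h₁ h₂⟩⟩
      essSurj := ⟨fun X => by
        have := hJ.triangulated
        obtain ⟨A, B, hA, hB, ⟨φ⟩⟩ := hE.exists_decomposition X
        exact ⟨(⟨A, hA⟩, ⟨B, hB⟩), ⟨φ⟩⟩⟩ }

/-- The projection onto the second summand becomes an isomorphism in the stable category when
the first summand is projective. -/
def stableSndIso (A B : K) (hA : relProj E A) :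
    (stableProj E).obj (A ⊞ B) ≅ (stableProj E).obj B where
  hom := (stableProj E).map biprod.snd
  inv := (stableProj E).map biprod.inr
  hom_inv_id := by
    rw [← (stableProj E).map_comp, ← (stableProj E).map_id, stableProj_map_eq_iff]
    -- The difference is `biprod.snd ≫ biprod.inr - 𝟙`, hence the sign.
    exact ⟨A, biprod.fst, -biprod.inl, hA, by simp [← biprod.total]⟩
  inv_hom_id := by
    rw [← (stableProj E).map_comp, biprod.inr_snd, (stableProj E).map_id]

/-- A map out of an object of the orthogonal that factors through a projective vanishes, and π
discards the projective summand of any object. -/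
lemma IsFrobeniusClass.isEquivalence_projOrthogonal (hE : IsFrobeniusClass E)
    [(relProj E).IsTriangulated] [IsIdempotentComplete K] :
    ((projOrthogonal E).ι ⋙ stableProj E).IsEquivalence where
  faithful := ⟨fun {X Y f g} h => by
    change (stableProj E).map f.hom = (stableProj E).map g.hom at h
    obtain ⟨P, a, b, hP, h⟩ := (stableProj_map_eq_iff _ _).1 h
    ext
    rw [X.2.2 a hP, zero_comp, sub_eq_zero] at h
    exact h⟩
  full := inferInstance
  essSurj := ⟨fun X => by
    obtain ⟨A, B, hA, hB, ⟨φ⟩⟩ := hE.exists_decomposition X.as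
    exact ⟨⟨B, hB⟩, ⟨(stableSndIso A B hA).symm ≪≫ (stableProj E).mapIso φ⟩⟩⟩

variable (E) in
/-- In the stable category, a sum of a projective and an object of `J'` is identified with its
second summand. -/
def sumFunctorCompStableProjIso (J' : ObjectProperty K) :
    sumFunctor (relProj E) J' ⋙ stableProj E ≅
      CategoryTheory.Prod.snd _ _ ⋙ J'.ι ⋙ stableProj E :=
  NatIso.ofComponents (fun X => stableSndIso X.1.1 X.2.1 X.1.2) (fun {X Y} f => by
    have key : (stableProj E).map (biprod.map f.1.hom f.2.hom) ≫ (stableProj E).map biprod.snd =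
        (stableProj E).map biprod.snd ≫ (stableProj E).map f.2.hom := by
      rw [← Functor.map_comp, ← Functor.map_comp, biprod.map_snd]
    exact key)

lemma PreenvelopeChoice.IsExact.comp {hE : IsFrobeniusClass E} {I : PreenvelopeChoice E}
    {C : Type u'} [Category.{v'} C] [HasZeroObject C] [HasShift C ℤ] [Preadditive C]
    [∀ n : ℤ, (shiftFunctor C n).Additive] [Pretriangulated C] (F : C ⥤ K) [F.CommShift ℤ]
    [F.IsTriangulated] {G : K ⥤ StableCategory E} (hG : I.IsExact hE G) :
    I.IsExact hE (F ⋙ G) := by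
  obtain ⟨_, φ, hφ⟩ := hG
  let ψ : shiftFunctor C (1 : ℤ) ⋙ F ⋙ G ≅ (F ⋙ G) ⋙ I.suspension hE :=
    (Functor.associator _ _ _).symm ≪≫ Functor.isoWhiskerRight (F.commShiftIso (1 : ℤ)) G ≪≫
      Functor.associator _ _ _ ≪≫ Functor.isoWhiskerLeft F φ ≪≫ (Functor.associator _ _ _).symm
  have hψ (X : C) :
      ψ.hom.app X = G.map ((F.commShiftIso (1 : ℤ)).hom.app X) ≫ φ.hom.app (F.obj X) := by
    simp [ψ]
  refine ⟨inferInstance, ψ, fun T hT => ?_⟩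
  change I.IsDistinguished hE (G.map (F.map T.mor₁)) (G.map (F.map T.mor₂))
    (G.map (F.map T.mor₃) ≫ ψ.hom.app T.obj₁)
  rw [hψ, ← Category.assoc, ← G.map_comp]
  exact hφ _ (F.map_distinguished T hT)

end Decomposition

end RelativeStable

end

theorem mainTheorem8 {K : Type u} [Category.{v} K] [HasZeroObject K] [HasShift K ℤ]
    [Preadditive K] [∀ n : ℤ, (shiftFunctor K n).Additive] [Pretriangulated K]
    [IsTriangulated K] (E : ObjectProperty (Triangle K))
    (hE : RelativeStable.IsFrobeniusClass E) (I : RelativeStable.PreenvelopeChoice E) :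
    (I.IsExact hE (RelativeStable.stableProj E) ↔
      RelativeStable.IsVerdierLocalization (RelativeStable.stableProj E)) ∧
    (RelativeStable.IsVerdierLocalization (RelativeStable.stableProj E) →
      IsIdempotentComplete K →
      ∃ (J' : ObjectProperty K) (_ : J'.IsTriangulated),
        RelativeStable.IsOrthogonalDecomposition (RelativeStable.relProj E) J' ∧
        (J'.ι ⋙ RelativeStable.stableProj E).IsEquivalence ∧
        I.IsExact hE (J'.ι ⋙ RelativeStable.stableProj E) ∧
        Nonempty (RelativeStable.sumFunctor (RelativeStable.relProj E) J' ⋙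
            RelativeStable.stableProj E ≅
          CategoryTheory.Prod.snd _ _ ⋙ J'.ι ⋙ RelativeStable.stableProj E)) := by
  refine ⟨⟨I.isVerdierLocalization_of_isExact hE, I.isExact_of_isVerdierLocalization hE⟩,
    fun hV _ => ?_⟩
  obtain ⟨hJ, -⟩ := hV.isThick_relProj
  have := hJ.triangulated
  have : (RelativeStable.projOrthogonal E).IsTriangulated := inferInstance
  exact ⟨RelativeStable.projOrthogonal E, this, hE.isOrthogonalDecomposition hJ,
    hE.isEquivalence_projOrthogonal, (I.isExact_of_isVerdierLocalization hE hV).comp _,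
    ⟨RelativeStable.sumFunctorCompStableProjIso E _⟩⟩
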